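/- Let $\mathcal G$ be a finite multigraph (multiple edges and loops allowed). Every edge, loops included, gives rise to two distinct opposite oriented edges $\vec e$ and $\vec e^{\,-1}$, and every oriented edge carries a weight $w(\vec e)\ge 0$ such that each edge has at least one orientation of positive weight and, for every vertex $u$, the weights of the oriented edges going out of $u$ sum to $1$. The random walk (RW) on such a weighted (possibly infinite) graph is the Markov chain on its vertices with transition matrix $$P(u,v)=\tfrac12\mathbf 1_{\{u=v\}}+\tfrac12\sum_{\vec e:\,u\to v}w(\vec e).$$ Given a vertex $v_*$ of $\mathcal G$, the universal cover $(\mathcal T_{\mathcal G},\circ)$ rooted at $v_*$ is the tree whose vertices are the non-backtracking paths $(\vec e_1,\dots,\vec e_m)$, $m\ge 0$, of oriented edges of $\mathcal G$ starting at $v_*$ (the end vertex of $\vec e_i$ is the initial vertex of $\vec e_{i+1}$, and $\vec e_{i+1}\ne \vec e_i^{\,-1}$, for $1\le i<m$); its root $\circ$ is the empty path, each path of length $m\ge 1$ is joined by an edge to the path $(\vec e_1,\dots,\vec e_{m-1})$, and the orientations of that edge towards and away from $(\vec e_1,\dots,\vec e_m)$ have the weights $w(\vec e_m)$ and $w(\vec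 e_m^{\,-1})$. A Markov chain is transient if, from each state, it has probability less than $1$ of ever returning to that state at a positive time. An oriented cycle of length $m\ge1$ is a cyclic order $C=(\vec e_1,\dots,\vec e_m)$ of $m$ distinct oriented edges of positive weight such that, for all $i$ mod $m$, the end vertex of $\vec e_i$ is the initial vertex of $\vec e_{i+1}$ and $\vec e_i\ne \vec e_{i+1}^{\,-1}$; its inverse is $C^{-1}=(\vec e_m^{\,-1},\dots,\vec e_1^{\,-1})$. **Proposition.** Assume that the RW on $\mathcal G$ is irreducible, and let $v_*$ be any vertex of $\mathcal G$. Then the RW on the universal cover $(\mathcal T_{\mathcal G},\circ)$ rooted at $v_*$ is transient if and only if - either $\mathcal G$ has at least two different oriented cycles which are not each other's inverse (two-cycles property), - or $\mathcal G$ has an oriented cycle $(\vec e_1,\dots,\vec e_m)$, $m\ge1$, such that $w(\vec e_1)\cdots w(\vec e_m)\ne w(\vec e_m^{\,-1})\cdots w(\vec e_1^{\,-1})$. -/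

import Mathlib

open scoped NNReal ENNReal

noncomputable section

/-- A weighted multigraph with vertex set `V` and set of oriented edges `E`. Every non-oriented edge
(loops included) is a pair `{e, rev e}` of two distinct opposite oriented edges. -/
structure WeightedGraph (V E : Type*) where
  /-- initial vertex -/
  src : E → V
  /-- end vertex -/
  tgt : E → V
  /-- opposite oriented edge -/
  rev : E → E
  /-- weight -/
  w : E → ℝ≥0
  rev_rev : ∀ e, rev (rev e) = e
  rev_ne : ∀ e, rev e ≠ e
  src_rev : ∀ e, src (rev e) = tgt e
  pos_or_pos : ∀ e, 0 < w e ∨ 0 < w (rev e)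
  hasSum_w : ∀ u, HasSum (fun e : {e : E // src e = u} => w e) 1

/-! ### Markov chains on a discrete state space -/

namespace MarkovChain

variable {S : Type*} (P : S → S → ℝ≥0∞)

/-- The `n`-step transition probability from `x` to `y`. -/
def stepProb : ℕ → S → S → ℝ≥0∞
  | 0, x, y => by classical exact if x = y then 1 else 0
  | n + 1, x, y => ∑' z, P x z * stepProb n z y

/-- The chain is irreducible. -/
def Irreducible : Prop := ∀ x y, ∃ n, 0 < stepProb P n x y

/-- `firstVisitProb P x n y` is the probability that the chain `(X_t)` started at `y` satisfies
`X_{n+1} = x` and `X_t ≠ x` for `1 ≤ t ≤ n`, that is, that its first visit to `x` at a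
positive time takes place at time `n + 1`. -/
def firstVisitProb (x : S) : ℕ → S → ℝ≥0∞
  | 0, y => P y x
  | n + 1, y => ∑' z : {z : S // z ≠ x}, P y z * firstVisitProb x n z

/-- The probability that the chain started at `x` returns to `x` at some positive time. -/
def returnProb (x : S) : ℝ≥0∞ := ∑' n, firstVisitProb P x n x

/-- The chain is transient: from every state, it has a positive probability of never returning. -/
def Transient : Prop := ∀ x, returnProb P x < 1

end MarkovChain

namespace WeightedGraph

variable {V E : Type*} (G : WeightedGraph V E)

/-- The transition matrix of the (lazy) random walk on `G`. -/
def transition (u v : V) : ℝ≥0∞ :=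
  2⁻¹ * (by classical exact if u = v then 1 else 0) +
    2⁻¹ * ∑' e : {e : E // G.src e = u ∧ G.tgt e = v}, (G.w e : ℝ≥0∞)

/-- An oriented cycle: a cyclic order of `m ≥ 1` (distinct) oriented edges of positive weight, such
that each edge ends where the next one starts and is not the opposite of the next one. -/
def IsOrientedCycle (C : Cycle E) : Prop :=
  C ≠ Cycle.nil ∧ C.Nodup ∧ (∀ e ∈ C, 0 < G.w e) ∧
    C.Chain (fun e f => G.tgt e = G.src f ∧ e ≠ G.rev f)

/-- The inverse of a cycle. -/
def cycleInv (C : Cycle E) : Cycle E := (C.map G.rev).reverse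

/-- Two-cycles property: there are two different oriented cycles which are not each other's
inverse. -/
def TwoCycles : Prop :=
  ∃ C D : Cycle E, G.IsOrientedCycle C ∧ G.IsOrientedCycle D ∧ C ≠ D ∧ C ≠ G.cycleInv D

/-- The product of the weights along a cycle. -/
def cycleWeight (C : Cycle E) : ℝ≥0 := (C.toMultiset.map G.w).prod

/-- The end vertex of a path starting at `r`. A path `(e₁, …, e_m)` is stored with its last edge
first, as the list `[e_m, …, e₁]`. -/
def pathEnd (r : V) : List E → V
  | [] => r
  | e :: _ => G.tgt e

/-- The list `[e_m, …, e₁]` is a non-backtracking path `(e₁, …, e_m)` starting at `r`. -/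
def IsNonBacktracking (r : V) : List E → Prop
  | [] => True
  | e :: l => G.src e = G.pathEnd r l ∧ (∀ f ∈ l.head?, e ≠ G.rev f) ∧ IsNonBacktracking r l

/-- Vertices of the universal cover rooted at `r`: the non-backtracking paths starting at `r`. -/
def CoverVertex (r : V) : Type _ := {l : List E // G.IsNonBacktracking r l}

/-- Oriented edges of the universal cover: a vertex `x` with label `u` has one outgoing oriented
edge for each oriented edge of `G` with initial vertex `u`. -/
def CoverEdge (r : V) : Type _ :=
  {a : G.CoverVertex r × E // G.src a.2 = G.pathEnd r a.1.1}

/-- Follow the edge `e` after the path `l`: if `e` is the opposite of the last edge of `l` that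
last edge is removed, otherwise `e` is appended to the path. -/
def follow (l : List E) (e : E) : List E :=
  match l with
  | [] => [e]
  | f :: l' => by classical exact if e = G.rev f then l' else e :: f :: l'

variable {G}

theorem follow_isNonBacktracking {r : V} {l : List E} {e : E} (hl : G.IsNonBacktracking r l)
    (he : G.src e = G.pathEnd r l) : G.IsNonBacktracking r (G.follow l e) := by
  cases l with
  | nil => exact ⟨he, by simp, trivial⟩
  | cons f l' =>
    by_cases h : e = G.rev f
    · simpa [follow, h] using hl.2.2
    · have h1 : G.IsNonBacktracking r (e :: f :: l') := ⟨he, by simpa using h, hl⟩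
      have h2 : G.follow (f :: l') e = e :: f :: l' := by simp [follow, h]
      rw [h2]
      exact h1

theorem pathEnd_follow {r : V} {l : List E} {e : E} (hl : G.IsNonBacktracking r l) :
    G.pathEnd r (G.follow l e) = G.tgt e := by
  cases l with
  | nil => rfl
  | cons f l' =>
    by_cases h : e = G.rev f
    · subst h
      have h1 := G.src_rev (G.rev f)
      rw [G.rev_rev] at h1
      simpa [follow, ← h1] using hl.1.symm
    · simp [follow, h, pathEnd]

theorem follow_follow {r : V} {l : List E} {e : E} (hl : G.IsNonBacktracking r l) :
    G.follow (G.follow l e) (G.rev e) = l := by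
  cases l with
  | nil => simp [follow]
  | cons f l' =>
    by_cases h : e = G.rev f
    · subst h
      rw [G.rev_rev]
      have h2 : G.follow (f :: l') (G.rev f) = l' := by simp [follow]
      rw [h2]
      cases l' with
      | nil => rfl
      | cons g l'' =>
        have h3 : f ≠ G.rev g := hl.2.1 g (by simp)
        simp [follow, h3]
    · simp [follow, h]

variable (G)

/-- The end vertex of an oriented edge of the universal cover. -/
def coverTgt {r : V} (a : G.CoverEdge r) : G.CoverVertex r :=
  ⟨G.follow a.1.1.1 a.1.2, follow_isNonBacktracking a.1.1.2 a.2⟩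

/-- The universal cover of `G` rooted at `r` (the root being the empty path), each oriented edge
having the weight of its label. -/
def universalCover (r : V) : WeightedGraph (G.CoverVertex r) (G.CoverEdge r) where
  src a := a.1.1
  tgt a := G.coverTgt a
  rev a := ⟨(G.coverTgt a, G.rev a.1.2), by
    rw [G.src_rev]
    exact (pathEnd_follow a.1.1.2).symm⟩
  w a := G.w a.1.2
  rev_rev a := Subtype.ext (Prod.ext (Subtype.ext (follow_follow a.1.1.2)) (G.rev_rev _))
  rev_ne a h := G.rev_ne a.1.2 (congrArg (fun b : G.CoverEdge r => b.1.2) h)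
  src_rev _ := rfl
  pos_or_pos a := G.pos_or_pos a.1.2
  hasSum_w x := by
    let φ : {e : E // G.src e = G.pathEnd r x.1} ≃ {a : G.CoverEdge r // a.1.1 = x} :=
      { toFun := fun e => ⟨⟨(x, e.1), e.2⟩, rfl⟩
        invFun := fun a => ⟨a.1.1.2, by have h := a.1.2; rw [a.2] at h; exact h⟩
        left_inv := fun _ => rfl
        right_inv := fun a => by
          obtain ⟨⟨⟨y, e⟩, he⟩, rfl⟩ := a
          rfl }
    exact (φ.hasSum_iff (f := fun a : {a : G.CoverEdge r // a.1.1 = x} => G.w a.1.1.2)).1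
      (G.hasSum_w (G.pathEnd r x.1))

end WeightedGraph

end

/-! ### Hitting probabilities and superharmonic functions -/

namespace MarkovChain

variable {S : Type*} (P : S → S → ℝ≥0∞)

/-! The heuristic unknown is the probability `r e` that the walk on the cover, after crossing an
edge labelled `e` away from a base point, never crosses it back. Laziness cancels, and `r e = s / (w
(rev e) + s)` with `s = nextSum r e`. `IsEscape` keeps only `≤`. Under irreducibility, the cover is
transient exactly when some subsolution has `w e * r e > 0`: the product of `1 - r` along reduced
paths is then superharmonic (`returnProb_lt_one_of_isEscape`), and conversely hitting probabilities
of the root produce a subsolution (`exists_isEscape_of_returnProb_lt_one`).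

For small `r` the condition is nearly linear: `r e * w (rev e) ≤ nextSum r e`, with some slack. A
cycle heavier than its inverse amplifies values transported around it, which provides the slack. If
all cycles are balanced, two circuits that diverge after a common edge provide it together.

Conversely, balance and irreducibility make all weights positive, and then the two-cycles property
fails exactly when every edge has at most one successor from which it can be reached again
(`UniqueRecStep`). Following edges with `r > 0` then ends in a periodic orbit with `r e * w (rev e)
< w e' * r e'` for consecutive `e`, `e'`. Multiplying around the orbit contradicts balance
(`IsEscape.not_balanced`). -/

theorem tsum_eq_add_tsum_ne (g : S → ℝ≥0∞) (x : S) :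
    ∑' z, g z = g x + ∑' z : {z : S // z ≠ x}, g z := by
  have h := (ENNReal.summable (f := fun z : ({x} : Set S) => g z)).tsum_add_tsum_compl
    (ENNReal.summable (f := fun z : (({x} : Set S)ᶜ : Set S) => g z))
  rw [← h, tsum_singleton x g]
  rfl

/-- The probability of ever visiting `x` for the chain started at `y`, time `0` included. -/
noncomputable def hitProb (x y : S) : ℝ≥0∞ := by
  classical exact if y = x then 1 else ∑' n, firstVisitProb P x n y

theorem hitProb_self (x : S) : hitProb P x x = 1 := by simp [hitProb]

theorem hitProb_of_ne {x y : S} (h : y ≠ x) :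
    hitProb P x y = ∑' n, firstVisitProb P x n y := by simp [hitProb, h]

/-- First-step analysis; the convention `hitProb P x x = 1` accounts for a first step that lands on
`x`. -/
theorem tsum_firstVisitProb (x y : S) :
    ∑' n, firstVisitProb P x n y = ∑' z, P y z * hitProb P x z := by
  rw [tsum_eq_zero_add' ENNReal.summable, tsum_eq_add_tsum_ne _ x, hitProb_self, mul_one]
  simp only [firstVisitProb]
  rw [ENNReal.tsum_comm]
  congr 1
  refine tsum_congr fun z => ?_
  rw [ENNReal.tsum_mul_left, hitProb_of_ne P z.2]

/-- A nonnegative superharmonic function which is at least `1` at `x` bounds the probability of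
visiting `x`. -/
theorem tsum_firstVisitProb_le {f : S → ℝ≥0∞} {x : S} (hf : ∀ y, ∑' z, P y z * f z ≤ f y)
    (hx : 1 ≤ f x) (y : S) : ∑' n, firstVisitProb P x n y ≤ ∑' z, P y z * f z := by
  rw [ENNReal.tsum_eq_iSup_nat]
  refine iSup_le fun N => ?_
  induction N generalizing y with
  | zero => simp
  | succ N ih =>
    rw [Finset.sum_range_succ', tsum_eq_add_tsum_ne _ x, add_comm]
    simp only [firstVisitProb]
    refine add_le_add (by simpa using mul_le_mul_right hx (P y x)) ?_
    rw [← Summable.tsum_finsetSum fun _ _ => ENNReal.summable]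
    refine ENNReal.tsum_le_tsum fun z => ?_
    rw [← Finset.mul_sum]
    gcongr
    exact (ih _).trans (hf _)

theorem hitProb_le_one (hP : ∀ y, ∑' z, P y z ≤ 1) (x y : S) : hitProb P x y ≤ 1 := by
  by_cases h : y = x
  · rw [h, hitProb_self]
  · rw [hitProb_of_ne P h]
    refine (tsum_firstVisitProb_le P (f := fun _ => 1) (by simpa using hP) le_rfl y).trans ?_
    simpa using hP y

end MarkovChain

/-! ### Escape functions and one step of the walk on the cover -/

namespace WeightedGraph

variable {V E : Type*} (G : WeightedGraph V E)

theorem tsum_transition_mul (u : V) (f : V → ℝ≥0∞) :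
    ∑' v, G.transition u v * f v =
      2⁻¹ * f u + 2⁻¹ * ∑' e : {e : E // G.src e = u}, (G.w e : ℝ≥0∞) * f (G.tgt e) := by
  classical
  simp only [transition, add_mul, ENNReal.tsum_add, mul_assoc, ENNReal.tsum_mul_left]
  congr 2
  · rw [tsum_eq_single u (fun v hv => by simp [hv.symm])]
    simp
  · have h1 : ∀ v, (∑' e : {e : E // G.src e = u ∧ G.tgt e = v}, (G.w e : ℝ≥0∞)) * f v =
        ∑' e, if G.src e = u ∧ G.tgt e = v then (G.w e : ℝ≥0∞) * f (G.tgt e) else 0 := by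
      intro v
      rw [← ENNReal.tsum_mul_right]
      have := tsum_subtype {e : E | G.src e = u ∧ G.tgt e = v}
        (fun e => (G.w e : ℝ≥0∞) * f v)
      refine Eq.trans this (tsum_congr fun e => ?_)
      by_cases h : G.src e = u ∧ G.tgt e = v
      · simp [Set.indicator, h.1, h.2]
      · simp [Set.indicator, h]
    simp_rw [h1]
    rw [ENNReal.tsum_comm]
    have := tsum_subtype {e : E | G.src e = u} (fun e => (G.w e : ℝ≥0∞) * f (G.tgt e))
    refine Eq.trans (tsum_congr fun e => ?_) this.symm
    rw [tsum_eq_single (G.tgt e) (fun v hv => by simp [hv.symm])]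
    simp [Set.indicator]

variable [Fintype E]

open Classical in
/-- The sum of `w f * r f` over the edges `f` that can follow `e` in a non-backtracking path. -/
noncomputable def nextSum (r : E → ℝ≥0) (e : E) : ℝ≥0 :=
  ∑ f with G.src f = G.tgt e ∧ f ≠ G.rev e, G.w f * r f

open Classical in
theorem sum_w (u : V) : ∑ e with G.src e = u, G.w e = 1 := by
  rw [← (G.hasSum_w u).tsum_eq, tsum_fintype, Finset.sum_subtype]
  simp

open Classical in
theorem sum_src_tgt {M : Type*} [AddCommMonoid M] (e : E) (g : E → M) :
    ∑ f with G.src f = G.tgt e, g f =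
      g (G.rev e) + ∑ f with G.src f = G.tgt e ∧ f ≠ G.rev e, g f := by
  rw [← Finset.add_sum_erase _ _ (a := G.rev e) (by simp [G.src_rev])]
  congr 2
  ext f
  simp [and_comm]

theorem w_rev_add_nextSum_one (e : E) : G.w (G.rev e) + G.nextSum (fun _ => 1) e = 1 := by
  classical
  simp only [nextSum, mul_one]
  rw [← G.sum_src_tgt e, G.sum_w]

/-- An escape function: a subsolution of the equations satisfied by the probabilities never to
come back through an edge of the universal cover. -/
def IsEscape (r : E → ℝ≥0) : Prop :=
  ∀ e, r e ≤ 1 ∧ r e * (G.w (G.rev e) + G.nextSum r e) ≤ G.nextSum r e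

theorem nextSum_add (r q : E → ℝ≥0) (e : E) :
    G.nextSum (fun f => r f + q f) e = G.nextSum r e + G.nextSum q e := by
  simp [nextSum, mul_add, Finset.sum_add_distrib]

variable {G} in
-- The right side is the return inequality: cross back at once, or go on through `f`, come back
-- through `f`, and then still come back through `e`. Since the weights out of a vertex sum to 1,
-- substituting `q = 1 - r` turns one side into the other.
theorem escape_iff_return {r q : E → ℝ≥0} (h : ∀ e, r e + q e = 1) (e : E) :
    r e * (G.w (G.rev e) + G.nextSum r e) ≤ G.nextSum r e ↔
      G.w (G.rev e) + q e * G.nextSum q e ≤ q e := by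
  have h1 := G.w_rev_add_nextSum_one e
  rw [show (fun _ : E => (1 : ℝ≥0)) = fun f => r f + q f from funext fun f => (h f).symm,
    nextSum_add] at h1
  have h2 := h e
  rw [← NNReal.coe_inj] at h1 h2
  rw [← NNReal.coe_le_coe, ← NNReal.coe_le_coe]
  push_cast at *
  have h3 : (q e : ℝ) = 1 - r e := by linarith
  have h4 : (G.nextSum q e : ℝ) = 1 - G.w (G.rev e) - G.nextSum r e := by linarith
  rw [h3, h4]
  constructor <;> intro h5 <;> nlinarith

open Classical in
theorem tsum_transition_universalCover (v : V) (x : G.CoverVertex v) (F : List E → ℝ≥0∞) :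
    ∑' y, (G.universalCover v).transition x y * F y.1 =
      2⁻¹ * F x.1 + 2⁻¹ * ∑ e with G.src e = G.pathEnd v x.1,
        (G.w e : ℝ≥0∞) * F (G.follow x.1 e) := by
  rw [tsum_transition_mul _ x (fun y => F y.1)]
  congr 2
  let φ : {e : E // G.src e = G.pathEnd v x.1} ≃
      {a : G.CoverEdge v // (G.universalCover v).src a = x} :=
    { toFun := fun e => ⟨⟨(x, e.1), e.2⟩, rfl⟩
      invFun := fun a => ⟨a.1.1.2, by
        have h := a.1.2
        rw [show a.1.1.1 = x from a.2] at h
        exact h⟩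
      left_inv := fun _ => rfl
      right_inv := fun a => by
        obtain ⟨⟨⟨y, e⟩, he⟩, rfl⟩ := a
        rfl }
  rw [← φ.tsum_eq, tsum_fintype]
  rw [Finset.sum_subtype (p := fun e => G.src e = G.pathEnd v x.1) _ (by simp)
    (fun e => (G.w e : ℝ≥0∞) * F (G.follow x.1 e))]
  rfl

open Classical in
theorem sum_follow_cons (v : V) (e : E) (l : List E)
    (F : List E → ℝ≥0∞) :
    ∑ f with G.src f = G.pathEnd v (e :: l), (G.w f : ℝ≥0∞) * F (G.follow (e :: l) f) =
      G.w (G.rev e) * F l +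
        ∑ f with G.src f = G.tgt e ∧ f ≠ G.rev e, (G.w f : ℝ≥0∞) * F (f :: e :: l) := by
  rw [show G.pathEnd v (e :: l) = G.tgt e from rfl, sum_src_tgt]
  congr 1
  · simp [follow]
  · refine Finset.sum_congr rfl fun f hf => ?_
    simp only [Finset.mem_filter] at hf
    simp [follow, hf.2.2]

end WeightedGraph

/-! ### From transience to an escape function -/

namespace WeightedGraph

variable {V E : Type*} (G : WeightedGraph V E) [Fintype E]

theorem tsum_transition_universalCover_le_one (v : V) (x : G.CoverVertex v) :
    ∑' y, (G.universalCover v).transition x y ≤ 1 := by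
  classical
  have h := G.tsum_transition_universalCover v x fun _ => 1
  simp only [mul_one] at h
  rw [h, ← ENNReal.ofNNReal_finsetSum, sum_w]
  simp [ENNReal.inv_two_add_inv_two]

/-- The root of the universal cover. -/
def coverRoot (v : V) : G.CoverVertex v := ⟨[], trivial⟩

theorem exists_isEscape_of_returnProb_lt_one (v : V)
    (h : MarkovChain.returnProb (G.universalCover v).transition (G.coverRoot v) < 1) :
    ∃ r, G.IsEscape r ∧ ∃ e, 0 < G.w e * r e := by
  classical
  set P := (G.universalCover v).transition with hP
  let root := G.coverRoot v
  -- Hitting probabilities of the root, extended by 0 to lists that are not vertices of the cover.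
  let F : List E → ℝ≥0∞ := fun l =>
    if hl : G.IsNonBacktracking v l then MarkovChain.hitProb P root ⟨l, hl⟩ else 0
  have hF : ∀ x : G.CoverVertex v, F x.1 = MarkovChain.hitProb P root x := fun x => by
    simp only [F, x.2, dif_pos]
    rfl
  have hF1 : ∀ l, F l ≤ 1 := by
    intro l
    by_cases hl : G.IsNonBacktracking v l
    · rw [hF ⟨l, hl⟩]
      exact MarkovChain.hitProb_le_one P (G.tsum_transition_universalCover_le_one v) _ _
    · simp [F, hl]
  have hstep : ∀ e l, G.IsNonBacktracking v (e :: l) →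
      G.w (G.rev e) * F l + ∑ f with G.src f = G.tgt e ∧ f ≠ G.rev e,
        (G.w f : ℝ≥0∞) * F (f :: e :: l) ≤ F (e :: l) := by
    intro e l hl
    -- Harmonicity away from the root; the lazy half is then cancelled, as `F` is finite.
    have h1 : F (e :: l) = 2⁻¹ * F (e :: l) + 2⁻¹ * (G.w (G.rev e) * F l +
        ∑ f with G.src f = G.tgt e ∧ f ≠ G.rev e, (G.w f : ℝ≥0∞) * F (f :: e :: l)) := by
      rw [← G.sum_follow_cons v e l F]
      let y : G.CoverVertex v := ⟨e :: l, hl⟩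
      change F y.1 = _
      rw [← G.tsum_transition_universalCover v y F]
      simp_rw [hF]
      rw [← MarkovChain.tsum_firstVisitProb, ← MarkovChain.hitProb_of_ne]
      exact fun h => List.cons_ne_nil _ _ (congrArg Subtype.val h)
    have h2 : F (e :: l) = 2⁻¹ * F (e :: l) + 2⁻¹ * F (e :: l) := by
      rw [← add_mul, ENNReal.inv_two_add_inv_two, one_mul]
    have h3 : 2⁻¹ * F (e :: l) ≠ ∞ :=
      ENNReal.mul_ne_top (by simp) (ne_top_of_le_ne_top ENNReal.one_ne_top (hF1 _))
    have h4 := h1.symm.trans h2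
    have h5 := (ENNReal.add_right_inj h3).1 h4
    exact ((ENNReal.mul_right_inj (by simp) (by simp)).1 h5).le
  -- `Q e` is the best constant for which crossing any copy of `e` costs at least a factor `Q e`.
  -- This avoids proving that the return probability depends only on the label.
  let A : E → Set ℝ≥0∞ := fun e =>
    {t | t ≤ 1 ∧ ∀ l, G.IsNonBacktracking v (e :: l) → t * F l ≤ F (e :: l)}
  let Q : E → ℝ≥0∞ := fun e => sSup (A e)
  have hQ1 : ∀ e, Q e ≤ 1 := fun e => sSup_le fun t ht => ht.1
  have hQ2 : ∀ e l, G.IsNonBacktracking v (e :: l) → Q e * F l ≤ F (e :: l) := by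
    intro e l hl
    simp only [Q]
    rw [ENNReal.sSup_mul]
    exact iSup₂_le fun t ht => ht.2 l hl
  let q : E → ℝ≥0 := fun e => (Q e).toNNReal
  have hq : ∀ e, (q e : ℝ≥0∞) = Q e := fun e =>
    ENNReal.coe_toNNReal (ne_top_of_le_ne_top ENNReal.one_ne_top (hQ1 e))
  have hq1 : ∀ e, q e ≤ 1 := fun e => by
    rw [← ENNReal.coe_le_coe, hq]
    exact hQ1 e
  -- The left side is itself an admissible constant in `A e`, hence at most the supremum.
  have hsuper : ∀ e, G.w (G.rev e) + q e * G.nextSum q e ≤ q e := by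
    intro e
    rw [← ENNReal.coe_le_coe, hq e]
    refine le_sSup ⟨?_, fun l hl => ?_⟩
    · rw [← ENNReal.coe_one, ENNReal.coe_le_coe, ← G.w_rev_add_nextSum_one e]
      gcongr
      refine (mul_le_of_le_one_left (zero_le) (hq1 e)).trans ?_
      unfold nextSum
      gcongr
      exact hq1 _
    · refine le_trans ?_ (hstep e l hl)
      push_cast
      rw [add_mul]
      gcongr
      rw [nextSum, ENNReal.ofNNReal_finsetSum, mul_assoc, mul_comm, mul_assoc, Finset.sum_mul]
      refine Finset.sum_le_sum fun f hf => ?_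
      simp only [Finset.mem_filter, Finset.mem_univ, true_and] at hf
      push_cast
      rw [mul_assoc]
      gcongr
      calc (q f : ℝ≥0∞) * (F l * q e) = Q f * (Q e * F l) := by rw [hq, hq]; ring
        _ ≤ Q f * F (e :: l) := by gcongr; exact hQ2 e l hl
        _ ≤ _ := hQ2 f _ ⟨hf.1, by simpa using hf.2, hl⟩
  refine ⟨fun e => 1 - q e, fun e => ⟨tsub_le_self, ?_⟩, ?_⟩
  · exact (escape_iff_return (fun e => tsub_add_cancel_of_le (hq1 e)) e).2 (hsuper e)
  -- Otherwise `q e = 1` whenever `w e > 0`, so every possible first step from the root leads back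
  -- with probability 1.
  · by_contra! hcon
    refine h.not_ge ?_
    unfold MarkovChain.returnProb
    rw [MarkovChain.tsum_firstVisitProb]
    rw [tsum_congr fun z => congrArg _ (hF z).symm]
    rw [G.tsum_transition_universalCover v (G.coverRoot v) F]
    have h3 : F [] = 1 := (hF root).trans (MarkovChain.hitProb_self P root)
    have h1 : (1 : ℝ≥0∞) ≤ ∑ e with G.src e = v, (G.w e : ℝ≥0∞) * F [e] := by
      rw [← ENNReal.coe_one, ← G.sum_w v, ENNReal.ofNNReal_finsetSum]
      refine Finset.sum_le_sum fun e he => ?_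
      simp only [Finset.mem_filter, Finset.mem_univ, true_and] at he
      have h2 := hQ2 e [] ⟨he, by simp, trivial⟩
      rw [h3, mul_one, ← hq] at h2
      refine le_trans (le_of_eq ?_) (mul_le_mul_right h2 _)
      rw [← ENNReal.coe_mul, ENNReal.coe_inj]
      have h4 := hcon e
      rcases mul_eq_zero.1 (le_antisymm h4 zero_le) with h5 | h5
      · simp [h5]
      · rw [le_antisymm (hq1 e) (tsub_eq_zero_iff_le.1 h5), mul_one]
    calc (1 : ℝ≥0∞) = 2⁻¹ * 1 + 2⁻¹ * 1 := by simp [ENNReal.inv_two_add_inv_two]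
      _ = 2⁻¹ * F [] + 2⁻¹ * 1 := by rw [h3]
      _ ≤ 2⁻¹ * F [] + 2⁻¹ * ∑ e with G.src e = v, (G.w e : ℝ≥0∞) * F [e] := by gcongr

/-- The reduced path from the end of `x` to the end of `y`, for two paths `x` and `y` with the same
initial vertex. -/
noncomputable def pathBetween (x y : List E) : List E :=
  y.foldr (fun e acc => G.follow acc e) (x.foldl (fun acc e => G.follow acc (G.rev e)) [])

end WeightedGraph

/-! ### From an escape function to transience -/

namespace WeightedGraph

variable {V E : Type*} {G : WeightedGraph V E}

theorem isNonBacktracking_foldl_follow {u v : V} {x acc : List E} (hx : G.IsNonBacktracking v x)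
    (hacc : G.IsNonBacktracking u acc) (h : G.pathEnd u acc = G.pathEnd v x) :
    G.IsNonBacktracking u (x.foldl (fun acc e => G.follow acc (G.rev e)) acc) ∧
      G.pathEnd u (x.foldl (fun acc e => G.follow acc (G.rev e)) acc) = v := by
  induction x generalizing acc with
  | nil => exact ⟨hacc, h⟩
  | cons e x ih =>
    refine ih hx.2.2 (follow_isNonBacktracking hacc ?_) ?_
    · rw [G.src_rev, h]
      rfl
    · rw [pathEnd_follow hacc, ← hx.1, ← G.src_rev, G.rev_rev]

theorem isNonBacktracking_foldr_follow {u v : V} {y acc : List E} (hy : G.IsNonBacktracking v y)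
    (hacc : G.IsNonBacktracking u acc) (h : G.pathEnd u acc = v) :
    G.IsNonBacktracking u (y.foldr (fun e acc => G.follow acc e) acc) ∧
      G.pathEnd u (y.foldr (fun e acc => G.follow acc e) acc) = G.pathEnd v y := by
  induction y with
  | nil => exact ⟨hacc, h⟩
  | cons e y ih =>
    obtain ⟨h1, h2⟩ := ih hy.2.2
    exact ⟨follow_isNonBacktracking h1 (by rw [h2, hy.1]), pathEnd_follow h1⟩

theorem pathBetween_isNonBacktracking {v : V} {x y : List E} (hx : G.IsNonBacktracking v x)
    (hy : G.IsNonBacktracking v y) :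
    G.IsNonBacktracking (G.pathEnd v x) (G.pathBetween x y) ∧
      G.pathEnd (G.pathEnd v x) (G.pathBetween x y) = G.pathEnd v y :=
  have h := isNonBacktracking_foldl_follow (u := G.pathEnd v x) (acc := []) hx trivial rfl
  isNonBacktracking_foldr_follow hy h.1 h.2

theorem foldr_follow_foldl_follow {u v : V} {x acc : List E} (hx : G.IsNonBacktracking v x)
    (hacc : G.IsNonBacktracking u acc) (h : G.pathEnd u acc = G.pathEnd v x) :
    x.foldr (fun e acc => G.follow acc e)
      (x.foldl (fun acc e => G.follow acc (G.rev e)) acc) = acc := by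
  induction x generalizing acc with
  | nil => rfl
  | cons e x ih =>
    rw [List.foldr_cons, List.foldl_cons, ih hx.2.2]
    · have := follow_follow (e := G.rev e) hacc
      rwa [G.rev_rev] at this
    · refine follow_isNonBacktracking hacc ?_
      rw [G.src_rev, h]
      rfl
    · rw [pathEnd_follow hacc, ← hx.1, ← G.src_rev, G.rev_rev]

theorem pathBetween_self {v : V} {x : List E} (hx : G.IsNonBacktracking v x) :
    G.pathBetween x x = [] :=
  foldr_follow_foldl_follow (u := G.pathEnd v x) hx trivial rfl

/-- Crossing an edge at `y` acts in the same way on the reduced path from `x`, so any vertex can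
serve as the root. -/
theorem pathBetween_follow {v : V} {x y : List E} (hx : G.IsNonBacktracking v x)
    (hy : G.IsNonBacktracking v y) (e : E) :
    G.pathBetween x (G.follow y e) = G.follow (G.pathBetween x y) e := by
  cases y with
  | nil => simp [follow, pathBetween]
  | cons f y =>
    by_cases h : e = G.rev f
    · subst h
      have h1 := follow_follow (e := f) (pathBetween_isNonBacktracking hx hy.2.2).1
      simpa [follow, pathBetween] using h1.symm
    · simp [follow, pathBetween, h]

theorem returnProb_lt_one_of_isEscape [Fintype E] {r : E → ℝ≥0} (hr : G.IsEscape r) {v : V}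
    (x : G.CoverVertex v) {e : E} (he : G.src e = G.pathEnd v x.1) (hpos : 0 < G.w e * r e) :
    MarkovChain.returnProb (G.universalCover v).transition x < 1 := by
  classical
  set q : E → ℝ≥0 := fun e => 1 - r e
  have hq : ∀ e, r e + q e = 1 := fun e => add_tsub_cancel_of_le (hr e).1
  have hq1 : ∀ e, q e ≤ 1 := fun e => tsub_le_self
  have hsuper : ∀ e, G.w (G.rev e) + q e * G.nextSum q e ≤ q e := fun e =>
    (escape_iff_return hq e).1 (hr e).2
  let φ : List E → ℝ≥0∞ := fun l => ((l.map q).prod : ℝ≥0)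
  let F : List E → ℝ≥0∞ := fun y => φ (G.pathBetween x.1 y)
  have hstep : ∀ y : G.CoverVertex v, ∑' z, (G.universalCover v).transition y z * F z.1 =
      2⁻¹ * F y.1 + 2⁻¹ * ∑ e with G.src e = G.pathEnd v y.1,
        (G.w e : ℝ≥0∞) * φ (G.follow (G.pathBetween x.1 y.1) e) := by
    intro y
    rw [G.tsum_transition_universalCover v y F]
    simp only [F]
    congr 2
    exact Finset.sum_congr rfl fun e _ => by rw [pathBetween_follow x.2 y.2]
  have hhalf : ∀ t : ℝ≥0∞, t = 2⁻¹ * t + 2⁻¹ * t := fun t => by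
    rw [← add_mul, ENNReal.inv_two_add_inv_two, one_mul]
  -- Strictness at the base point comes from the edge `e` with `w e * r e > 0`.
  have hnil : ∑ e with G.src e = G.pathEnd v x.1, (G.w e : ℝ≥0∞) * φ (G.follow [] e) < 1 := by
    simp only [φ, follow, List.map_cons, List.map_nil, List.prod_cons, List.prod_nil, mul_one]
    norm_cast
    rw [← G.sum_w (G.pathEnd v x.1)]
    refine Finset.sum_lt_sum (fun e _ => mul_le_of_le_one_right zero_le (hq1 e))
      ⟨e, by simpa using he, ?_⟩
    have h1 : 0 < G.w e := pos_of_mul_pos_left hpos zero_le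
    have h2 : 0 < r e := pos_of_mul_pos_right hpos zero_le
    refine mul_lt_of_lt_one_right h1 ?_
    rw [← hq e]
    exact lt_add_of_pos_left _ h2
  have hxF : F x.1 = 1 := by simp [F, φ, pathBetween_self x.2]
  have hsup : ∀ y : G.CoverVertex v,
      ∑' z, (G.universalCover v).transition y z * F z.1 ≤ F y.1 := by
    intro y
    rw [hstep y]
    obtain ⟨h1, h2⟩ := pathBetween_isNonBacktracking x.2 y.2
    have key : ∑ e with G.src e = G.pathEnd v y.1,
        (G.w e : ℝ≥0∞) * φ (G.follow (G.pathBetween x.1 y.1) e) ≤ F y.1 := by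
      rw [← h2]
      simp only [F]
      rcases hL : G.pathBetween x.1 y.1 with _ | ⟨f, L⟩
      · refine hnil.le.trans ?_
        simp [φ]
      · rw [sum_follow_cons]
        have h3 := mul_le_mul_left (hsuper f) (L.map q).prod
        simp only [φ, List.map_cons, List.prod_cons]
        norm_cast
        refine le_trans (le_of_eq ?_) h3
        rw [add_mul, nextSum, Finset.mul_sum, Finset.sum_mul]
        congr 1
        exact Finset.sum_congr rfl fun _ _ => by ring
    calc _ ≤ 2⁻¹ * F y.1 + 2⁻¹ * F y.1 := by gcongr
      _ = _ := (hhalf _).symm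
  unfold MarkovChain.returnProb
  refine (MarkovChain.tsum_firstVisitProb_le _ hsup hxF.ge x).trans_lt ?_
  rw [hstep x, pathBetween_self x.2, hxF]
  refine lt_of_lt_of_eq ?_ (hhalf 1).symm
  exact ENNReal.add_lt_add_left (by simp) 
    ((ENNReal.mul_lt_mul_iff_right (by simp) (by simp)).2 hnil)

end WeightedGraph

/-! ### Building escape functions from circuits -/

namespace MarkovChain

theorem reflTransGen_of_stepProb_pos {S : Type*} {P : S → S → ℝ≥0∞} {n : ℕ} {x y : S}
    (h : 0 < stepProb P n x y) : Relation.ReflTransGen (fun x y => 0 < P x y) x y := by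
  induction n generalizing x with
  | zero =>
    by_cases hxy : x = y
    · rw [hxy]
    · simp [stepProb, hxy] at h
  | succ n ih =>
    obtain ⟨z, hz⟩ : ∃ z, P x z * stepProb P n z y ≠ 0 := by
      by_contra! hcon
      simp [stepProb, hcon] at h
    exact .head (pos_iff_ne_zero.2 (left_ne_zero_of_mul hz))
      (ih (pos_iff_ne_zero.2 (right_ne_zero_of_mul hz)))

end MarkovChain

namespace WeightedGraph

section

variable {V E : Type*} (G : WeightedGraph V E)

/-- There is an oriented edge of positive weight from `u` to `v`. -/
def PosAdj (u v : V) : Prop := ∃ e, G.src e = u ∧ G.tgt e = v ∧ 0 < G.w e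

/-- Two oriented edges of positive weight that are consecutive in a non-backtracking path. -/
def Step (e f : E) : Prop := 0 < G.w e ∧ 0 < G.w f ∧ G.tgt e = G.src f ∧ e ≠ G.rev f

/-- The edges `e`, followed by those of `t`, form a simple non-backtracking closed path in which
`f` comes right after `e`. -/
def IsCircuit (e f : E) (t : List E) : Prop :=
  (e :: t).Nodup ∧ List.IsChain G.Step (e :: (t ++ [e])) ∧ (t ++ [e]).head? = some f

variable {G}

theorem reflTransGen_posAdj (h : MarkovChain.Irreducible G.transition) (u v : V) :
    Relation.ReflTransGen G.PosAdj u v := by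
  obtain ⟨n, hn⟩ := h u v
  refine Relation.reflTransGen_closed (fun {a b} hab => ?_)
    u v (MarkovChain.reflTransGen_of_stepProb_pos hn)
  by_cases h1 : a = b
  · rw [h1]
  obtain ⟨⟨e, he1, he2⟩, he⟩ : ∃ e : {e : E // G.src e = a ∧ G.tgt e = b}, (G.w e : ℝ≥0∞) ≠ 0 := by
    by_contra! hcon
    simp only [transition, h1, if_false, mul_zero, zero_add] at hab
    rw [ENNReal.tsum_eq_zero.2 hcon, mul_zero] at hab
    exact lt_irrefl _ hab
  exact .single ⟨e, he1, he2, pos_iff_ne_zero.2 (by simpa using he)⟩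

theorem IsCircuit.step {e f : E} {t : List E} (h : G.IsCircuit e f t) : G.Step e f := by
  obtain ⟨-, h2, h3⟩ := h
  cases t with
  | nil => simp_all
  | cons g t => simp_all

open Topology in
theorem eventually_prod_lt (a : E → ℝ≥0) (l : List E) {c : ℝ≥0} (h : (l.map a).prod < c) :
    ∀ᶠ δ in 𝓝[>] (0 : ℝ≥0), (l.map fun e => a e + δ).prod < c := by
  have h1 : Continuous fun δ : ℝ≥0 => (l.map fun e => a e + δ).prod :=
    continuous_list_prod l fun e _ => by fun_prop
  refine nhdsWithin_le_nhds (h1.continuousAt.eventually_lt continuousAt_const ?_)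
  simpa using h

end

variable {V E : Type*} [Fintype E] {G : WeightedGraph V E}

theorem nextSum_mono {r r' : E → ℝ≥0} (h : r ≤ r') (e : E) : G.nextSum r e ≤ G.nextSum r' e := by
  unfold nextSum
  gcongr
  exact h _

theorem le_nextSum (r : E → ℝ≥0) {e f : E} (h : G.Step e f) : G.w f * r f ≤ G.nextSum r e := by
  classical
  refine Finset.single_le_sum (f := fun f => G.w f * r f) (fun _ _ => zero_le) ?_
  simp only [Finset.mem_filter, Finset.mem_univ, true_and]
  refine ⟨h.2.2.1.symm, fun h1 => h.2.2.2 ?_⟩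
  rw [h1, G.rev_rev]

theorem add_le_nextSum (r : E → ℝ≥0) {e f f' : E} (h : G.Step e f) (h' : G.Step e f')
    (hne : f ≠ f') : G.w f * r f + G.w f' * r f' ≤ G.nextSum r e := by
  classical
  rw [← Finset.sum_pair hne (f := fun f => G.w f * r f)]
  refine Finset.sum_le_sum_of_subset fun g hg => ?_
  simp only [Finset.mem_insert, Finset.mem_singleton] at hg
  simp only [Finset.mem_filter, Finset.mem_univ, true_and]
  rcases hg with rfl | rfl
  · exact ⟨h.2.2.1.symm, fun h1 => h.2.2.2 (by rw [h1, G.rev_rev])⟩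
  · exact ⟨h'.2.2.1.symm, fun h1 => h'.2.2.2 (by rw [h1, G.rev_rev])⟩

theorem exists_pos_of_nextSum_pos {r : E → ℝ≥0} {e : E} (h : 0 < G.nextSum r e) :
    ∃ f, G.src f = G.tgt e ∧ f ≠ G.rev e ∧ 0 < G.w f * r f := by
  classical
  by_contra! hcon
  refine h.ne' (Finset.sum_eq_zero fun f hf => ?_)
  simp only [Finset.mem_filter, Finset.mem_univ, true_and] at hf
  exact le_antisymm (hcon f hf.1 hf.2) zero_le

theorem IsEscape.nextSum_pos {r : E → ℝ≥0} (hr : G.IsEscape r) {e : E} (h : 0 < r e)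
    (hw : 0 < G.w (G.rev e)) : 0 < G.nextSum r e :=
  lt_of_lt_of_le (mul_pos h (add_pos_of_pos_of_nonneg hw zero_le)) (hr e).2

/-- The ratio `s / (a + s)` increases with `s`, so raising some values of an escape function
preserves the inequalities at the others. -/
theorem escape_le_mono {t a s s' : ℝ≥0} (ht : t ≤ 1) (h : t * (a + s) ≤ s) (hs : s ≤ s') :
    t * (a + s') ≤ s' := by
  obtain ⟨d, rfl⟩ := exists_add_of_le hs
  calc t * (a + (s + d)) = t * (a + s) + t * d := by ring
    _ ≤ s + d := add_le_add h (mul_le_of_le_one_left zero_le ht)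

theorem exists_isEscape_at {r : E → ℝ≥0} (hr : G.IsEscape r) {e : E} (he : 0 < G.w e * r e) {v : V}
    (h : Relation.ReflTransGen G.PosAdj v (G.src e)) :
    ∃ r, G.IsEscape r ∧ ∃ e, G.src e = v ∧ 0 < G.w e * r e := by
  classical
  induction h using Relation.ReflTransGen.head_induction_on with
  | refl => exact ⟨r, hr, e, rfl, he⟩
  | head h _ ih =>
    obtain ⟨e, rfl, rfl, hwe⟩ := h
    obtain ⟨r, hr, f, hf, hpos⟩ := ih
    by_cases hre : 0 < r e
    · exact ⟨r, hr, e, rfl, mul_pos hwe hre⟩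
    -- If `f` would backtrack, a continuation `g` of `f` already starts at the required vertex.
    -- Otherwise `r e` is raised from 0 to the largest value that its inequality allows.
    by_cases hfe : f = G.rev e
    · subst hfe
      have h1 := hr.nextSum_pos (pos_of_mul_pos_right hpos zero_le) (by rwa [G.rev_rev])
      obtain ⟨g, hg1, -, hg2⟩ := exists_pos_of_nextSum_pos h1
      refine ⟨r, hr, g, ?_, hg2⟩
      rw [hg1, ← G.src_rev, G.rev_rev]
    · set s := G.nextSum r e with hs
      have hs0 : 0 < s := lt_of_lt_of_le hpos (le_nextSum r
        ⟨hwe, pos_of_mul_pos_left hpos zero_le, hf.symm, fun h => hfe (by rw [h, G.rev_rev])⟩)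
      have hd : 0 < G.w (G.rev e) + s := add_pos_of_nonneg_of_pos zero_le hs0
      set t := s / (G.w (G.rev e) + s)
      have hle : r ≤ Function.update r e t := by
        intro g
        by_cases hg : g = e
        · subst hg
          rw [le_antisymm (not_lt.1 hre) zero_le]
          exact zero_le
        · rw [Function.update_of_ne hg]
      refine ⟨Function.update r e t, fun g => ?_, e, rfl, ?_⟩
      · have h1 := nextSum_mono (G := G) hle g
        by_cases hg : g = e
        · subst hg
          rw [Function.update_self] at *
          have h2 : t ≤ 1 := div_le_one_of_le₀ le_add_self zero_le
          exact ⟨h2, escape_le_mono h2 (div_mul_cancel₀ _ hd.ne').le h1⟩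
        · rw [Function.update_of_ne hg]
          exact ⟨(hr g).1, escape_le_mono (hr g).1 (hr g).2 h1⟩
      · rw [Function.update_self]
        exact mul_pos hwe (div_pos hs0 hd)

theorem nextSum_const_mul (c : ℝ≥0) (r : E → ℝ≥0) (e : E) :
    G.nextSum (fun f => c * r f) e = c * G.nextSum r e := by
  rw [nextSum, nextSum, Finset.mul_sum]
  exact Finset.sum_congr rfl fun f _ => by ring

/-- A strict subsolution of the linearized equations yields an escape function. -/
theorem exists_isEscape_of_linear {ρ : E → ℝ≥0} {δ : ℝ≥0} (hδ : 0 < δ)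
    (h : ∀ e, ρ e * (G.w (G.rev e) + δ) ≤ G.nextSum ρ e) {e : E} (he : 0 < G.w e * ρ e) :
    ∃ r, G.IsEscape r ∧ ∃ e, 0 < G.w e * r e := by
  -- Dividing by `K` brings `ρ` below 1 and `nextSum` below `δ`, so the slack absorbs the quadratic
  -- term.
  set K : ℝ≥0 := 1 + ∑ e, ρ e + (∑ e, G.nextSum ρ e) / δ with hK
  have hK0 : 0 < K := by positivity
  refine ⟨fun e => K⁻¹ * ρ e, fun e => ⟨?_, ?_⟩, e, ?_⟩
  · rw [inv_mul_le_iff₀ hK0, mul_one, hK]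
    refine le_add_right (le_add_left ?_)
    exact Finset.single_le_sum (fun _ _ => zero_le) (Finset.mem_univ e)
  · rw [nextSum_const_mul, mul_assoc]
    refine mul_le_mul_right (le_trans ?_ (h e)) _
    gcongr
    rw [inv_mul_le_iff₀ hK0, hK, add_mul, div_mul_cancel₀ _ hδ.ne']
    refine le_add_left ?_
    exact Finset.single_le_sum (f := fun e => G.nextSum ρ e) (fun _ _ => zero_le)
      (Finset.mem_univ e)
  · rw [mul_left_comm]
    exact mul_pos (inv_pos.2 hK0) he

/-- Values propagate backwards along the path from `ρ e = 1`, each `g` receiving at least `w f' * ρ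
f' / b g` from its successor `f'`. Values only increase, so earlier inequalities survive. -/
theorem exists_profile_aux {b : E → ℝ≥0} (hb : ∀ g, 0 < b g) {e f : E} {p : List E} (he : e ∉ p)
    (hp : List.IsChain G.Step (p ++ [e])) (hf : (p ++ [e]).head? = some f) :
    ∃ ρ : E → ℝ≥0, ρ e = 1 ∧ (∀ g ≠ e, ρ g * b g ≤ G.nextSum ρ g) ∧
      G.w e * (p.map G.w).prod ≤ G.w f * ρ f * (p.map b).prod := by
  classical
  induction p generalizing f with
  | nil =>
    obtain rfl : e = f := by simpa using hf
    exact ⟨Pi.single e 1, by simp, fun g hg => by simp [hg], by simp⟩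
  | cons g p ih =>
    obtain rfl : g = f := by simpa using hf
    obtain ⟨f', hf'⟩ : ∃ f', (p ++ [e]).head? = some f' := by cases p <;> simp
    have hp' : List.IsChain G.Step (p ++ [e]) := List.IsChain.tail hp
    have hgf : G.Step g f' := by
      rw [List.cons_append, List.isChain_cons] at hp
      exact hp.1 f' hf'
    have hge : g ≠ e := fun h => he (by simp [h])
    obtain ⟨ρ, h1, h2, h3⟩ := ih (fun h => he (by simp [h])) hp' hf'
    set t := max (ρ g) (G.w f' * ρ f' / b g) with ht
    have hle : ρ ≤ Function.update ρ g t := by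
      intro h
      by_cases hg : h = g
      · subst hg
        rw [Function.update_self]
        exact le_max_left _ _
      · rw [Function.update_of_ne hg]
    refine ⟨Function.update ρ g t, by rwa [Function.update_of_ne hge.symm], fun h hh => ?_, ?_⟩
    · refine le_trans ?_ (nextSum_mono hle h)
      by_cases hg : h = g
      · subst hg
        rw [Function.update_self, ht, max_mul]
        refine max_le (h2 _ hge) ?_
        rw [div_mul_cancel₀ _ (hb h).ne']
        exact le_nextSum ρ hgf
      · rw [Function.update_of_ne hg]
        exact h2 h hh
    · rw [Function.update_self, List.map_cons, List.prod_cons, List.map_cons, List.prod_cons]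
      have h4 : G.w f' * ρ f' ≤ t * b g := by
        rw [← div_le_iff₀ (hb g)]
        exact le_max_right _ _
      calc G.w e * (G.w g * (p.map G.w).prod) = G.w g * (G.w e * (p.map G.w).prod) := by ring
        _ ≤ G.w g * (G.w f' * ρ f' * (p.map b).prod) := by gcongr
        _ ≤ G.w g * (t * b g * (p.map b).prod) := by gcongr
        _ = _ := by ring

/-- Once the circuit closes, only the inequality at `e` is open; it holds up to the factor `K`
comparing the two products. -/
theorem IsCircuit.exists_profile {b : E → ℝ≥0} (hb : ∀ g, 0 < b g) {e f : E} {t : List E}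
    (h : G.IsCircuit e f t) {K : ℝ≥0}
    (hK : ((e :: t).map b).prod ≤ K * ((e :: t).map G.w).prod) :
    ∃ ρ : E → ℝ≥0, ρ e = 1 ∧ (∀ g ≠ e, ρ g * b g ≤ G.nextSum ρ g) ∧
      b e ≤ K * (G.w f * ρ f) := by
  obtain ⟨ρ, h1, h2, h3⟩ := exists_profile_aux hb (List.nodup_cons.1 h.1).1
    (List.IsChain.tail h.2.1) h.2.2
  refine ⟨ρ, h1, h2, ?_⟩
  have h4 : 0 < (t.map b).prod := List.prod_pos (by simp [hb])
  simp only [List.map_cons, List.prod_cons] at hK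
  refine le_of_mul_le_mul_right ?_ h4
  calc b e * (t.map b).prod ≤ K * (G.w e * (t.map G.w).prod) := hK
    _ ≤ K * (G.w f * ρ f * (t.map b).prod) := by gcongr
    _ = _ := by ring

/-- An oriented cycle with a weight larger than that of its inverse gives an escape function. -/
theorem IsCircuit.exists_isEscape {e f : E} {t : List E} (h : G.IsCircuit e f t)
    (hw : ((e :: t).map fun g => G.w (G.rev g)).prod < ((e :: t).map G.w).prod) :
    ∃ r, G.IsEscape r ∧ ∃ e, 0 < G.w e * r e := by
  obtain ⟨δ, hδ, hδ0⟩ := ((eventually_prod_lt _ _ hw).and self_mem_nhdsWithin).exists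
  have hδ0 : 0 < δ := hδ0
  obtain ⟨ρ, h1, h2, h3⟩ := h.exists_profile (b := fun g => G.w (G.rev g) + δ) (K := 1)
    (fun g => by positivity) (by rw [one_mul]; exact hδ.le)
  refine exists_isEscape_of_linear hδ0 (ρ := ρ) (e := e) (fun g => ?_) ?_
  · by_cases hg : g = e
    · subst hg
      rw [h1, one_mul]
      rw [one_mul] at h3
      exact h3.trans (le_nextSum ρ h.step)
    · exact h2 g hg
  · rw [h1, mul_one]
    exact h.step.1

/-- Two balanced oriented cycles that diverge after a common edge give an escape function. -/
theorem IsCircuit.exists_isEscape_of_pair {e f f' : E} {t t' : List E} (h : G.IsCircuit e f t)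
    (h' : G.IsCircuit e f' t') (hne : f ≠ f') (hpos : ∀ e, 0 < G.w e)
    (hw : ((e :: t).map fun g => G.w (G.rev g)).prod = ((e :: t).map G.w).prod)
    (hw' : ((e :: t').map fun g => G.w (G.rev g)).prod = ((e :: t').map G.w).prod) :
    ∃ r, G.IsEscape r ∧ ∃ e, 0 < G.w e * r e := by
  -- The factor 2 leaves room for `δ`: each circuit supplies half of what is needed at `e`, and the
  -- contributions add up because `f ≠ f'`.
  have hlt : ∀ l : List E, (l.map G.w).prod < 2 * (l.map G.w).prod := fun l =>
    lt_mul_of_one_lt_left (List.prod_pos (by simp [hpos])) one_lt_two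
  obtain ⟨δ, ⟨hδ, hδ'⟩, hδ0⟩ := (((eventually_prod_lt _ _ (hw.trans_lt (hlt _))).and
    (eventually_prod_lt _ _ (hw'.trans_lt (hlt _)))).and self_mem_nhdsWithin).exists
  have hδ0 : 0 < δ := hδ0
  have hb : ∀ g, 0 < G.w (G.rev g) + δ := fun g => by positivity
  obtain ⟨ρ, h1, h2, h3⟩ := h.exists_profile hb hδ.le
  obtain ⟨ρ', h1', h2', h3'⟩ := h'.exists_profile hb hδ'.le
  have hle : ρ ≤ fun g => max (ρ g) (ρ' g) := fun g => le_max_left _ _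
  have hle' : ρ' ≤ fun g => max (ρ g) (ρ' g) := fun g => le_max_right _ _
  refine exists_isEscape_of_linear hδ0 (ρ := fun g => max (ρ g) (ρ' g)) (e := e) (fun g => ?_) ?_
  · by_cases hg : g = e
    · subst hg
      refine le_trans ?_ (add_le_nextSum _ h.step h'.step hne)
      have h4 : G.w f * ρ f + G.w f' * ρ' f' ≤
          G.w f * max (ρ f) (ρ' f) + G.w f' * max (ρ f') (ρ' f') :=
        add_le_add (mul_le_mul_right (hle f) _) (mul_le_mul_right (hle' f') _)
      refine le_trans ?_ h4
      rw [h1, h1', max_self, one_mul]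
      refine le_of_mul_le_mul_left ?_ (zero_lt_two (α := ℝ≥0))
      calc 2 * (G.w (G.rev g) + δ) = (G.w (G.rev g) + δ) + (G.w (G.rev g) + δ) := two_mul _
        _ ≤ 2 * (G.w f * ρ f) + 2 * (G.w f' * ρ' f') := add_le_add h3 h3'
        _ = _ := (mul_add _ _ _).symm
    · rw [max_mul]
      exact max_le ((h2 g hg).trans (nextSum_mono hle g)) ((h2' g hg).trans (nextSum_mono hle' g))
  · simp only [h1, h1', max_self, mul_one]
    exact hpos e

end WeightedGraph

/-! ### Oriented cycles, circuits and positivity of the weights -/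

namespace WeightedGraph

open Relation

section

variable {V E : Type*} {G : WeightedGraph V E}

/-- A step that lies on a closed non-backtracking path. -/
def RecStep (G : WeightedGraph V E) (e f : E) : Prop := G.Step e f ∧ ReflTransGen G.Step f e

/-- Every edge has at most one successor along closed non-backtracking paths. -/
def UniqueRecStep (G : WeightedGraph V E) : Prop :=
  ∀ e f f', G.RecStep e f → G.RecStep e f' → f = f'

/-- Every oriented cycle has the same weight as its inverse. -/
def Balanced (G : WeightedGraph V E) : Prop :=
  ∀ C, G.IsOrientedCycle C → G.cycleWeight C = G.cycleWeight (G.cycleInv C)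

/-- Loop erasure: if `a` recurs, everything before its recurrence is dropped. -/
theorem exists_nodup_chain {α : Type*} {R : α → α → Prop} {a b : α} (h : ReflTransGen R a b) :
    ∃ l, (a :: l).Nodup ∧ List.IsChain R (a :: l) ∧ (a :: l).getLast (by simp) = b := by
  induction h using ReflTransGen.head_induction_on with
  | refl => exact ⟨[], by simp⟩
  | @head a c hac _ ih =>
    obtain ⟨l, h1, h2, h3⟩ := ih
    by_cases ha : a ∈ c :: l
    · obtain ⟨s, t, hst⟩ := List.append_of_mem ha
      rw [hst] at h1 h2
      refine ⟨t, h1.of_append_right, h2.right_of_append, ?_⟩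
      rw [← h3]
      simp [hst]
    · refine ⟨c :: l, List.nodup_cons.2 ⟨ha, h1⟩, List.isChain_cons_cons.2 ⟨hac, h2⟩, ?_⟩
      rw [← h3, List.getLast_cons]

theorem RecStep.exists_isCircuit {e f : E} (h : G.RecStep e f) : ∃ t, G.IsCircuit e f t := by
  obtain ⟨l, h1, h2, h3⟩ := exists_nodup_chain h.2
  have h4 := List.dropLast_append_getLast (l := f :: l) (by simp)
  rw [h3] at h4
  refine ⟨(f :: l).dropLast, ?_, ?_, ?_⟩
  · rw [← h4] at h1
    exact (List.perm_append_singleton e _).nodup_iff.1 h1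
  · rw [h4]
    exact List.isChain_cons_cons.2 ⟨h.1, h2⟩
  · rw [h4]
    rfl

theorem reflTransGen_of_isChain_append {α : Type*} {R : α → α → Prop} {a b : α} {l : List α}
    (h : List.IsChain R (a :: (l ++ [b]))) : ReflTransGen R a b := by
  induction l generalizing a with
  | nil => exact .single (by simpa using h)
  | cons c l ih =>
    rw [List.cons_append, List.isChain_cons_cons] at h
    exact .head h.1 (ih h.2)

theorem IsCircuit.recStep {e f : E} {t : List E} (h : G.IsCircuit e f t) : G.RecStep e f := by
  refine ⟨h.step, ?_⟩
  obtain ⟨-, h2, h3⟩ := h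
  cases t with
  | nil =>
    obtain rfl : e = f := by simpa using h3
    exact .refl
  | cons g t =>
    obtain rfl : g = f := by simpa using h3
    exact reflTransGen_of_isChain_append (List.isChain_cons_cons.1 h2).2

theorem IsCircuit.isOrientedCycle {e f : E} {t : List E} (h : G.IsCircuit e f t) :
    G.IsOrientedCycle (e :: t : List E) := by
  refine ⟨by simp, Cycle.nodup_coe_iff.2 h.1, fun g hg => ?_, ?_⟩
  · obtain ⟨h1, h2⟩ := h
    have h3 : g ∈ e :: t := hg
    obtain ⟨s, t', hst⟩ := List.append_of_mem h3
    have h4 := h2.1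
    rw [← List.cons_append, hst, List.append_assoc] at h4
    have h5 := h4.right_of_append
    cases t' with
    | nil => exact (List.isChain_cons_cons.1 h5).1.1
    | cons a t' => exact (List.isChain_cons_cons.1 h5).1.1
  · rw [Cycle.chain_coe_cons]
    exact h.2.1.imp fun a b hab => hab.2.2

theorem IsOrientedCycle.chain_step {C : Cycle E} (h : G.IsOrientedCycle C) : C.Chain G.Step := by
  obtain ⟨-, -, h3, h4⟩ := h
  induction C using Cycle.induction_on with
  | nil => exact Cycle.Chain.nil _
  | cons a l _ =>
    rw [Cycle.chain_coe_cons] at h4 ⊢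
    have hp : ∀ g ∈ a :: (l ++ [a]), 0 < G.w g := by
      intro g hg
      refine h3 g ?_
      rw [Cycle.mem_coe_iff]
      simp at hg ⊢
      tauto
    clear h3
    generalize a :: (l ++ [a]) = l' at *
    induction l' with
    | nil => exact List.isChain_nil
    | cons x l' ih =>
      cases l' with
      | nil => exact List.isChain_singleton _
      | cons y l' =>
        rw [List.isChain_cons_cons] at h4 ⊢
        exact ⟨⟨hp x (by simp), hp y (by simp), h4.1⟩,
          ih h4.2 fun g hg => hp g (List.mem_cons_of_mem _ hg)⟩

theorem IsOrientedCycle.exists_isCircuit {C : Cycle E} (h : G.IsOrientedCycle C) {e : E}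
    (he : e ∈ C) : ∃ f t, C = (e :: t : List E) ∧ G.IsCircuit e f t := by
  obtain ⟨t, rfl⟩ : ∃ t : List E, C = (e :: t : List E) := by
    induction C using Quotient.inductionOn' with
    | h l =>
      obtain ⟨s, t, rfl⟩ := List.append_of_mem (show e ∈ l from he)
      refine ⟨t ++ s, ?_⟩
      exact Cycle.coe_eq_coe.2 (List.isRotated_append (l := s) (l' := e :: t))
  obtain ⟨f, hf⟩ : ∃ f, (t ++ [e]).head? = some f := by cases t <;> simp
  exact ⟨f, t, rfl, Cycle.nodup_coe_iff.1 h.2.1, (Cycle.chain_coe_cons _ _ _).1 h.chain_step, hf⟩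

theorem IsOrientedCycle.exists_mem {C : Cycle E} (h : G.IsOrientedCycle C) : ∃ e, e ∈ C := by
  induction C using Cycle.induction_on with
  | nil => exact absurd rfl h.1
  | cons a l _ => exact ⟨a, by simp⟩

theorem cycleWeight_coe (l : List E) : G.cycleWeight l = (l.map G.w).prod := by
  simp [cycleWeight]

theorem cycleWeight_cycleInv_coe (l : List E) :
    G.cycleWeight (G.cycleInv l) = (l.map fun e => G.w (G.rev e)).prod := by
  simp only [cycleWeight, cycleInv, Cycle.map_coe, Cycle.reverse_coe, Cycle.coe_toMultiset,
    Multiset.map_coe, Multiset.prod_coe, List.map_reverse, List.map_map, List.prod_reverse]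
  rfl

theorem cycleInv_cycleInv (C : Cycle E) : G.cycleInv (G.cycleInv C) = C := by
  induction C using Quotient.inductionOn' with
  | h l =>
    change G.cycleInv (G.cycleInv (l : Cycle E)) = l
    simp [cycleInv, Function.comp_def, G.rev_rev]

theorem length_cycleInv (C : Cycle E) : (G.cycleInv C).length = C.length := by
  induction C using Quotient.inductionOn' with
  | h l =>
    change (G.cycleInv (l : Cycle E)).length = (l : Cycle E).length
    simp [cycleInv]

theorem rev_mem_cycleInv {C : Cycle E} {e : E} (h : e ∈ C) : G.rev e ∈ G.cycleInv C := by
  rw [cycleInv, Cycle.mem_reverse_iff, Cycle.mem_map]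
  exact ⟨e, h, rfl⟩

theorem isOrientedCycle_cycleInv {C : Cycle E} (h : G.IsOrientedCycle C)
    (hpos : ∀ e ∈ C, 0 < G.w (G.rev e)) : G.IsOrientedCycle (G.cycleInv C) := by
  obtain ⟨h1, h2, -, h4⟩ := h
  refine ⟨?_, ?_, ?_, ?_⟩
  · intro h
    refine h1 ?_
    rw [← G.cycleInv_cycleInv C, h]
    rfl
  · induction C using Quotient.inductionOn' with
    | h l =>
      change (G.cycleInv (l : Cycle E)).Nodup
      simp only [cycleInv, Cycle.map_coe, Cycle.reverse_coe, Cycle.nodup_coe_iff,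
        List.nodup_reverse]
      exact List.Nodup.map (Function.LeftInverse.injective G.rev_rev) h2
  · intro e he
    rw [cycleInv, Cycle.mem_reverse_iff, Cycle.mem_map] at he
    obtain ⟨f, hf, rfl⟩ := he
    exact hpos f hf
  · induction C using Cycle.induction_on with
    | nil => exact Cycle.Chain.nil _
    | cons a l _ =>
      rw [Cycle.chain_coe_cons] at h4
      have h5 : G.cycleInv (a :: l : List E) = (G.rev a :: (l.map G.rev).reverse : List E) := by
        simp only [cycleInv, Cycle.map_coe, Cycle.reverse_coe, List.map_cons, List.reverse_cons]
        exact Cycle.coe_eq_coe.2 (List.isRotated_append (l := (l.map G.rev).reverse)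
          (l' := [G.rev a]))
      rw [h5, Cycle.chain_coe_cons]
      have h6 : G.rev a :: ((l.map G.rev).reverse ++ [G.rev a]) =
          ((a :: (l ++ [a])).map G.rev).reverse := by simp
      rw [h6, List.isChain_reverse, List.isChain_map]
      refine h4.imp fun x y hxy => ?_
      rw [G.src_rev, ← G.src_rev (G.rev y), G.rev_rev, G.rev_rev]
      exact ⟨hxy.1.symm, hxy.2.symm⟩

/-- If `w (rev e) = 0`, a positive path from the end of `e` back to its start cannot undo `e`, so
after reduction it closes up to a circuit through `e`, whose inverse has weight 0. -/
theorem pos_of_balanced (hb : G.Balanced) (hconn : ∀ u v, ReflTransGen G.PosAdj u v) (e : E) :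
    0 < G.w e := by
  obtain ⟨e, rfl⟩ : ∃ e', G.rev e' = e := ⟨_, G.rev_rev e⟩
  by_contra h0
  have h0 : G.w (G.rev e) = 0 := le_antisymm (not_lt.1 h0) zero_le
  have he : 0 < G.w e := (G.pos_or_pos e).resolve_right h0.not_gt
  have hreach : ∀ u, ReflTransGen G.PosAdj (G.tgt e) u →
      ∃ g, ReflTransGen G.Step e g ∧ 0 < G.w g ∧ G.tgt g = u := by
    intro u hu
    induction hu with
    | refl => exact ⟨e, .refl, he, rfl⟩
    | tail _ h ih =>
      obtain ⟨f, rfl, rfl, hf⟩ := h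
      obtain ⟨g, hg, hgw, hgf⟩ := ih
      by_cases hfg : g = G.rev f
      · subst hfg
        rcases hg.cases_tail with h1 | ⟨g', h1, h2⟩
        · rw [← h1, G.rev_rev] at h0
          exact absurd h0 hf.ne'
        · exact ⟨g', h1, h2.1, by rw [h2.2.2.1, G.src_rev]⟩
      · exact ⟨f, hg.tail ⟨hgw, hf, hgf, hfg⟩, hf, rfl⟩
  obtain ⟨g, hg, hgw, hge⟩ := hreach (G.src e) (hconn _ _)
  have hs : G.Step g e := ⟨hgw, he, hge, fun h => hgw.ne' (by rw [h, h0])⟩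
  obtain ⟨f, hf1, hf2⟩ := TransGen.head'_iff.1 (TransGen.tail' hg hs)
  obtain ⟨t, ht⟩ := RecStep.exists_isCircuit (G := G) ⟨hf1, hf2⟩
  have h1 := hb _ ht.isOrientedCycle
  have h2 : 0 < G.cycleWeight (e :: t : List E) := by
    rw [cycleWeight_coe]
    refine List.prod_pos fun x hx => ?_
    obtain ⟨g, hg, rfl⟩ := List.mem_map.1 hx
    exact ht.isOrientedCycle.2.2.1 g hg
  rw [h1, cycleWeight_cycleInv_coe] at h2
  simp [h0] at h2

end

/-! ### Uniqueness of recurrent successors -/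

section

variable {V E : Type*} {G : WeightedGraph V E}

theorem eq_of_isChain (hu : G.UniqueRecStep) {x e : E} {t t' : List E}
    (h : List.IsChain G.Step (x :: (t ++ [e]))) (h' : List.IsChain G.Step (x :: (t' ++ [e])))
    (he : e ∉ t) (he' : e ∉ t') (hx : ReflTransGen G.Step e x) : t = t' := by
  have hrec : ∀ {y : E} {s : List E}, List.IsChain G.Step (x :: (y :: s ++ [e])) →
      G.RecStep x y := fun h =>
    ⟨(List.isChain_cons_cons.1 h).1,
      (reflTransGen_of_isChain_append (List.isChain_cons_cons.1 h).2).trans hx⟩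
  have hnil : List.IsChain G.Step (x :: ([] ++ [e])) → G.RecStep x e := fun h =>
    ⟨(List.isChain_cons_cons.1 h).1, hx⟩
  induction t generalizing x t' with
  | nil =>
    cases t' with
    | nil => rfl
    | cons y t' => exact absurd (hu _ _ _ (hnil h) (hrec h')) fun h => he' (by simp [h])
  | cons y t ih =>
    cases t' with
    | nil => exact absurd (hu _ _ _ (hnil h') (hrec h)) fun h => he (by simp [h])
    | cons z t' =>
      obtain rfl := hu _ _ _ (hrec h) (hrec h')
      have hs := hx.tail (hrec h).1
      rw [ih (List.isChain_cons_cons.1 h).2 (List.isChain_cons_cons.1 h').2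
        (fun h => he (by simp [h])) (fun h => he' (by simp [h])) hs
        (fun h => ⟨(List.isChain_cons_cons.1 h).1,
          (reflTransGen_of_isChain_append (List.isChain_cons_cons.1 h).2).trans hs⟩)
        (fun h => ⟨(List.isChain_cons_cons.1 h).1, hs⟩)]

theorem IsOrientedCycle.eq_of_mem (hu : G.UniqueRecStep) {C D : Cycle E}
    (hC : G.IsOrientedCycle C) (hD : G.IsOrientedCycle D) {e : E} (h : e ∈ C) (h' : e ∈ D) :
    C = D := by
  obtain ⟨f, t, rfl, ht⟩ := hC.exists_isCircuit h
  obtain ⟨f', t', rfl, ht'⟩ := hD.exists_isCircuit h'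
  rw [eq_of_isChain hu ht.2.1 ht'.2.1 (List.nodup_cons.1 ht.1).1 (List.nodup_cons.1 ht'.1).1 .refl]

theorem IsOrientedCycle.mem_of_reflTransGen (hu : G.UniqueRecStep) {C : Cycle E}
    (hC : G.IsOrientedCycle C) {a b : E} (ha : a ∈ C) (hab : ReflTransGen G.Step a b)
    (hba : ReflTransGen G.Step b a) : b ∈ C := by
  induction hab with
  | refl => exact ha
  | @tail c b h1 h2 ih =>
    obtain ⟨f, t, rfl, ht⟩ := hC.exists_isCircuit (ih (.head h2 hba))
    obtain rfl := hu _ _ _ ht.recStep ⟨h2, hba.trans h1⟩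
    have h3 := List.mem_of_head? ht.2.2
    simp at h3 ⊢
    tauto

/-- A path from `e` to its inverse is a lasso: mutually inverse outer edges are peeled off until the
first and last inner edges no longer cancel, and what remains closes up. -/
theorem exists_isOrientedCycle_of_isChain_rev {e : E} {t : List E} (ht : t.Nodup)
    (h : List.IsChain G.Step (e :: (t ++ [G.rev e]))) :
    ∃ D, G.IsOrientedCycle D ∧ D.length ≤ t.length := by
  induction hn : t.length using Nat.strong_induction_on generalizing e t with
  | _ n ih =>
    subst hn
    rcases t with _ | ⟨x, t⟩
    · have h1 := (List.isChain_cons_cons.1 h).1.2.2.2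
      rw [G.rev_rev] at h1
      exact absurd rfl h1
    obtain ⟨hex, h1⟩ := List.isChain_cons_cons.1 h
    rcases List.eq_nil_or_concat' t with rfl | ⟨s, y, rfl⟩
    · have hx := (List.isChain_cons_cons.1 h1).1
      have hc : G.IsCircuit x x [] := by
        refine ⟨ht, ?_, rfl⟩
        refine List.isChain_cons_cons.2 ⟨⟨hx.1, hx.1, ?_, (G.rev_ne x).symm⟩,
          List.isChain_singleton _⟩
        rw [hx.2.2.1, G.src_rev, hex.2.2.1]
      exact ⟨_, hc.isOrientedCycle, le_rfl⟩
    · by_cases hy : y = G.rev x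
      · subst hy
        obtain ⟨D, hD, hlen⟩ := ih s.length (by simp) (t := s) (e := x)
          (List.nodup_append.1 (List.nodup_cons.1 ht).2).1 (List.IsChain.left_of_append h1) rfl
        refine ⟨D, hD, hlen.trans ?_⟩
        simp only [List.length_cons, List.length_append, List.length_nil]
        omega
      · have h2 : List.IsChain G.Step ((x :: s) ++ [y, G.rev e]) := by simpa using h1
        have hye := (List.isChain_cons_cons.1 h2.right_of_append).1
        have h3 : List.IsChain G.Step ((x :: s) ++ [y, x]) := by
          refine List.isChain_split.2 ⟨(List.isChain_split.1 h2).1, ?_⟩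
          refine List.isChain_cons_cons.2 ⟨⟨hye.1, hex.2.1, ?_, hy⟩, List.isChain_singleton _⟩
          rw [hye.2.2.1, G.src_rev, hex.2.2.1]
        obtain ⟨f, hf⟩ : ∃ f, (s ++ [y] ++ [x]).head? = some f := by cases s <;> simp
        have hc : G.IsCircuit x f (s ++ [y]) := ⟨ht, by simpa using h3, hf⟩
        exact ⟨_, hc.isOrientedCycle, le_rfl⟩

/-- Two recurrent successors give two circuits through `e`. If these are equal as cycles, the
successors agree. If they are mutually inverse, the circuit contains `e` and `rev e`, and the lasso
between them yields a shorter oriented cycle. -/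
theorem uniqueRecStep_of_not_twoCycles (h : ¬ G.TwoCycles) : G.UniqueRecStep := by
  have key : ∀ C D, G.IsOrientedCycle C → G.IsOrientedCycle D → C = D ∨ C = G.cycleInv D := by
    intro C D hC hD
    by_contra! hcon
    exact h ⟨C, D, hC, hD, hcon⟩
  intro e f f' hf hf'
  obtain ⟨t, ht⟩ := hf.exists_isCircuit
  obtain ⟨t', ht'⟩ := hf'.exists_isCircuit
  have hnext : ∀ {g : E} {t : List E}, G.IsCircuit e g t →
      Cycle.Chain (fun x y => x = e → y = g) (e :: t : List E) := by
    rintro g t ⟨h1, -, h3⟩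
    rw [Cycle.chain_coe_cons, List.isChain_cons]
    refine ⟨fun y hy _ => Option.some.inj (hy.symm.trans h3), ?_⟩
    have h4 := (List.nodup_cons.1 h1).1
    clear h1 h3
    induction t with
    | nil => exact List.isChain_singleton _
    | cons a t ih =>
      simp only [List.mem_cons, not_or] at h4
      rw [List.cons_append, List.isChain_cons]
      exact ⟨fun y _ h => absurd h.symm h4.1, ih h4.2⟩
  have hhead : ∀ {g g' : E} {t : List E}, G.IsCircuit e g t →
      Cycle.Chain (fun x y => x = e → y = g') (e :: t : List E) → g = g' := by
    intro g g' t ht hc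
    rw [Cycle.chain_coe_cons, List.isChain_cons] at hc
    exact hc.1 g ht.2.2 rfl
  rcases key _ _ ht.isOrientedCycle ht'.isOrientedCycle with heq | heq
  · refine hhead ht ?_
    rw [heq]
    exact hnext ht'
  · exfalso
    have h1 : G.rev e ∈ ((e :: t : List E) : Cycle E) := by
      rw [heq]
      exact rev_mem_cycleInv (by simp)
    obtain ⟨t1, t2, rfl⟩ := List.append_of_mem
      ((List.mem_cons.1 (Cycle.mem_coe_iff.1 h1)).resolve_left (G.rev_ne e))
    have h2 : List.IsChain G.Step ((e :: (t1 ++ [G.rev e])) ++ (t2 ++ [e])) := by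
      simpa using ht.2.1
    obtain ⟨D, hD, hlen⟩ := exists_isOrientedCycle_of_isChain_rev
      (List.nodup_append.1 (List.nodup_cons.1 ht.1).2).1 h2.left_of_append
    have h3 : D.length = (e :: (t1 ++ G.rev e :: t2)).length := by
      rcases key _ _ hD ht.isOrientedCycle with h | h
      · rw [h, Cycle.length_coe]
      · rw [h, length_cycleInv, Cycle.length_coe]
    simp at h3
    omega

end

/-! ### Closed classes of the step relation when all weights are positive -/

section

variable {V E : Type*} {G : WeightedGraph V E}

theorem Step.rev (hpos : ∀ e, 0 < G.w e) {e f : E} (h : G.Step e f) :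
    G.Step (G.rev f) (G.rev e) := by
  refine ⟨hpos _, hpos _, ?_, fun h1 => h.2.2.2 (by rw [h1, G.rev_rev])⟩
  rw [G.src_rev, h.2.2.1, ← G.src_rev, G.rev_rev]

theorem reflTransGen_step_rev (hpos : ∀ e, 0 < G.w e) {e f : E} (h : ReflTransGen G.Step e f) :
    ReflTransGen G.Step (G.rev f) (G.rev e) := by
  induction h with
  | refl => exact .refl
  | tail _ h ih => exact .head (h.rev hpos) ih

theorem tgt_rev (e : E) : G.tgt (G.rev e) = G.src e := by rw [← G.src_rev, G.rev_rev]

/-- A path that reaches a closed one can go around it and retrace its own steps; where this would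
backtrack, `f` itself lies on a closed path. -/
theorem reflTransGen_rev_or_transGen (hpos : ∀ e, 0 < G.w e) {f g : E}
    (h : ReflTransGen G.Step f g) (hg : TransGen G.Step g g) :
    ReflTransGen G.Step f (G.rev f) ∨ TransGen G.Step f f := by
  induction h using ReflTransGen.head_induction_on with
  | refl => exact .inr hg
  | @head f c h _ ih =>
    rcases ih with ih | ih
    · exact .inl (.head h (ih.tail (h.rev hpos)))
    · obtain ⟨a, h1, h2⟩ := TransGen.tail'_iff.1 ih
      by_cases ha : a = f
      · subst ha
        exact .inr (.head' h h1)
      · refine .inl (.head h (h1.tail ⟨hpos _, hpos _, ?_, ?_⟩))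
        · rw [h2.2.2.1, G.src_rev, h.2.2.1]
        · rwa [G.rev_rev]

/-- A non-backtracking path that leaves a closed one never gets to a closed one again. -/
theorem UniqueRecStep.eq_of_step (hu : G.UniqueRecStep) (hpos : ∀ e, 0 < G.w e) {e e' f g : E}
    (he : G.RecStep e e') (hf : G.Step e f) (hfg : ReflTransGen G.Step f g)
    (hg : TransGen G.Step g g) : f = e' := by
  by_contra hne
  -- Coming back to the fork and continuing through `e'` would make `f` a second recurrent successor
  -- of `e`.
  have hback : ∀ a, ReflTransGen G.Step f a → G.tgt a = G.src e' → a ≠ G.rev e' → False :=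
    fun a h1 h2 h3 => hne (hu e f e' ⟨hf, (h1.tail ⟨hpos _, hpos _, h2, h3⟩).trans he.2⟩ he)
  have hsrc : G.src f = G.src e' := hf.2.2.1.symm.trans he.1.2.2.1
  rcases reflTransGen_rev_or_transGen hpos hfg hg with h | h
  · refine hback _ h ((tgt_rev f).trans hsrc) fun h1 => hne ?_
    rw [← G.rev_rev f, h1, G.rev_rev]
  · obtain ⟨a, h1, h2⟩ := TransGen.tail'_iff.1 h
    by_cases ha : a = G.rev e'
    · subst ha
      have h3 := hu _ _ _ ⟨he.1.rev hpos, reflTransGen_step_rev hpos he.2⟩ ⟨h2, h1⟩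
      exact hf.2.2.2 (by rw [← h3, G.rev_rev])
    · exact hback a h1 (h2.2.2.1.trans hsrc) ha

theorem UniqueRecStep.reflTransGen_symm (hu : G.UniqueRecStep) (hpos : ∀ e, 0 < G.w e) {a b : E}
    (hab : ReflTransGen G.Step a b) (ha : TransGen G.Step a a) (hb : TransGen G.Step b b) :
    ReflTransGen G.Step b a := by
  induction hab using ReflTransGen.head_induction_on with
  | refl => exact .refl
  | @head a c hac hcb ih =>
    obtain ⟨a', h1, h2⟩ := TransGen.head'_iff.1 ha
    obtain rfl := hu.eq_of_step hpos ⟨h1, h2⟩ hac hcb hb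
    exact (ih (.tail' h2 h1)).trans h2

/-- Backtracking is erased step by step; when it would erase the starting edge too, the path
restarts from the opposite orientation. -/
theorem exists_reflTransGen_tgt (hpos : ∀ e, 0 < G.w e) (e : E) {u : V}
    (hu : ReflTransGen G.PosAdj (G.tgt e) u) :
    ∃ g, (ReflTransGen G.Step e g ∨ ReflTransGen G.Step (G.rev e) g) ∧ G.tgt g = u := by
  induction hu with
  | refl => exact ⟨e, .inl .refl, rfl⟩
  | tail _ h ih =>
    obtain ⟨f, rfl, rfl, hf⟩ := h
    obtain ⟨g, hg, hgf⟩ := ih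
    by_cases hfg : g = G.rev f
    · subst hfg
      have h3 : ∀ {a : E}, ReflTransGen G.Step a (G.rev f) → G.rev f = a ∨
          ∃ g, ReflTransGen G.Step a g ∧ G.tgt g = G.tgt f := by
        intro a ha
        rcases ha.cases_tail with h1 | ⟨g', h1, h2⟩
        · exact .inl h1
        · exact .inr ⟨g', h1, by rw [h2.2.2.1, G.src_rev]⟩
      rcases hg with hg | hg
      · rcases h3 hg with h4 | ⟨g, h4, h5⟩
        · exact ⟨G.rev e, .inr .refl, by rw [← h4, G.rev_rev]⟩
        · exact ⟨g, .inl h4, h5⟩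
      · rcases h3 hg with h4 | ⟨g, h4, h5⟩
        · exact ⟨e, .inl .refl, by rw [← G.rev_rev e, ← h4, G.rev_rev]⟩
        · exact ⟨g, .inr h4, h5⟩
    · have hs : G.Step g f := ⟨hpos _, hf, hgf, hfg⟩
      exact ⟨f, hg.imp (·.tail hs) (·.tail hs), rfl⟩

/-- By connectedness, one of `C` and its inverse leads to one of `D` and its inverse. A path between
closed paths never leaves its class, so these two cycles coincide. -/
theorem UniqueRecStep.not_twoCycles (hu : G.UniqueRecStep) (hpos : ∀ e, 0 < G.w e)
    (hconn : ∀ u v, ReflTransGen G.PosAdj u v) : ¬ G.TwoCycles := by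
  rintro ⟨C, D, hC, hD, hne, hne'⟩
  have hC' := isOrientedCycle_cycleInv hC fun _ _ => hpos _
  have hD' := isOrientedCycle_cycleInv hD fun _ _ => hpos _
  have hrec : ∀ {B : Cycle E} {x : E}, G.IsOrientedCycle B → x ∈ B → TransGen G.Step x x := by
    intro B x hB hx
    obtain ⟨y, t, rfl, ht⟩ := hB.exists_isCircuit hx
    exact .head' ht.recStep.1 ht.recStep.2
  have key : ∀ {A B : Cycle E} {a b : E}, G.IsOrientedCycle A → G.IsOrientedCycle B → a ∈ A →
      b ∈ B → ReflTransGen G.Step a b → A = B := by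
    intro A B a b hA hB ha hb hab
    exact hA.eq_of_mem hu hB (hA.mem_of_reflTransGen hu ha hab
      (hu.reflTransGen_symm hpos hab (hrec hA ha) (hrec hB hb))) hb
  obtain ⟨c, hc⟩ := hC.exists_mem
  obtain ⟨d, hd⟩ := hD.exists_mem
  obtain ⟨d', t, hDt, ht⟩ := hD.exists_isCircuit hd
  have hd' : d' ∈ D := hD.mem_of_reflTransGen hu hd (.single ht.step) ht.recStep.2
  obtain ⟨g, hg, hgt⟩ := exists_reflTransGen_tgt hpos c (hconn _ (G.src d'))
  obtain ⟨A, hA, a, ha, hag⟩ : ∃ A, (A = C ∨ A = G.cycleInv C) ∧ ∃ a ∈ A,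
      ReflTransGen G.Step a g := by
    rcases hg with h | h
    · exact ⟨C, .inl rfl, c, hc, h⟩
    · exact ⟨_, .inr rfl, _, rev_mem_cycleInv hc, h⟩
  obtain ⟨B, hB, b, hb, hgb⟩ : ∃ B, (B = D ∨ B = G.cycleInv D) ∧ ∃ b ∈ B, G.Step g b := by
    by_cases h : g = G.rev d'
    · refine ⟨_, .inr rfl, _, rev_mem_cycleInv hd, ?_⟩
      rw [h]
      exact ht.step.rev hpos
    · exact ⟨D, .inl rfl, d', hd', hpos _, hpos _, hgt, h⟩
  have hA' : G.IsOrientedCycle A := by rcases hA with rfl | rfl <;> assumption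
  have hB' : G.IsOrientedCycle B := by rcases hB with rfl | rfl <;> assumption
  have hAB := key hA' hB' ha hb (hag.tail hgb)
  rcases hA with rfl | rfl <;> rcases hB with rfl | rfl
  · exact hne hAB
  · exact hne' hAB
  · exact hne' (by rw [← hAB, cycleInv_cycleInv])
  · exact hne (by rw [← G.cycleInv_cycleInv C, hAB, cycleInv_cycleInv])

end

/-! ### Escape functions force an unbalanced cycle -/

variable {V E : Type*} [Fintype E] {G : WeightedGraph V E}

/-- Under the uniqueness property, an escape function gives an unbalanced oriented cycle. -/
theorem IsEscape.not_balanced {r : E → ℝ≥0} (hr : G.IsEscape r) {e : E} (he : 0 < G.w e * r e)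
    (hu : G.UniqueRecStep) (hpos : ∀ e, 0 < G.w e) : ¬ G.Balanced := by
  classical
  have hnext : ∀ e : E, ∃ f, 0 < r e → G.Step e f ∧ 0 < r f := by
    intro e
    by_cases h : 0 < r e
    · obtain ⟨f, h1, h2, h3⟩ := exists_pos_of_nextSum_pos (hr.nextSum_pos h (hpos _))
      exact ⟨f, fun _ => ⟨⟨hpos _, hpos _, h1.symm, fun h => h2 (by rw [h, G.rev_rev])⟩,
        pos_of_mul_pos_right h3 zero_le⟩⟩
    · exact ⟨e, fun h1 => absurd h1 h⟩
  choose n hn using hnext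
  have hiter : ∀ {x : E}, 0 < r x → ∀ k, 0 < r (n^[k] x) := by
    intro x hx k
    induction k with
    | zero => exact hx
    | succ k ih =>
      rw [Function.iterate_succ_apply']
      exact (hn _ ih).2
  have hreach : ∀ {x : E}, 0 < r x → ∀ k, ReflTransGen G.Step x (n^[k] x) := by
    intro x hx k
    induction k with
    | zero => exact .refl
    | succ k ih =>
      rw [Function.iterate_succ_apply']
      exact ih.tail (hn _ (hiter hx k)).1
  have hper : ∀ x : E, ∃ i, n^[i] x ∈ Function.periodicPts n := by
    intro x
    obtain ⟨i, j, hij, h⟩ := Finite.exists_ne_map_eq_of_infinite fun k => n^[k] x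
    wlog hlt : i < j generalizing i j
    · exact this j i hij.symm h.symm (lt_of_le_of_ne (not_lt.1 hlt) hij.symm)
    refine ⟨i, Function.mk_mem_periodicPts (Nat.sub_pos_of_lt hlt) ?_⟩
    rw [Function.IsPeriodicPt, Function.IsFixedPt, ← Function.iterate_add_apply,
      Nat.sub_add_cancel hlt.le]
    exact h.symm
  have hrec : ∀ {x : E}, 0 < r x → x ∈ Function.periodicPts n → G.RecStep x (n x) := by
    rintro x hx ⟨p, hp, hxp⟩
    obtain ⟨p, rfl⟩ := Nat.exists_eq_succ_of_ne_zero hp.ne'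
    refine ⟨(hn x hx).1, ?_⟩
    have h1 := hreach (hn x hx).2 p
    rwa [← Function.iterate_succ_apply, hxp.eq] at h1
  have hlt : ∀ {x : E}, 0 < r x → x ∈ Function.periodicPts n →
      r x * G.w (G.rev x) < G.w (n x) * r (n x) := by
    intro x hx hxp
    -- Any other successor with `r > 0` would also lead to a periodic orbit of `n`, which
    -- `eq_of_step` forbids.
    have hs : G.nextSum r x = G.w (n x) * r (n x) := by
      refine Finset.sum_eq_single_of_mem _ ?_ fun f hf hfn => ?_
      · have h1 := (hn x hx).1
        simp only [Finset.mem_filter, Finset.mem_univ, true_and]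
        exact ⟨h1.2.2.1.symm, fun h => h1.2.2.2 (by rw [h, G.rev_rev])⟩
      · simp only [Finset.mem_filter, Finset.mem_univ, true_and] at hf
        by_contra h0
        have hrf : 0 < r f := pos_iff_ne_zero.2 (right_ne_zero_of_mul h0)
        obtain ⟨i, hi⟩ := hper f
        have h1 := hrec (hiter hrf i) hi
        exact hfn (hu.eq_of_step hpos (hrec hx hxp)
          ⟨hpos _, hpos _, hf.1.symm, fun h => hf.2 (by rw [h, G.rev_rev])⟩
          (hreach hrf i) (.head' h1.1 h1.2))
    have h1 := (hr x).2
    rw [hs, mul_add] at h1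
    refine lt_of_lt_of_le (lt_add_of_pos_right _ ?_) h1
    exact mul_pos hx (mul_pos (hpos _) (hn x hx).2)
  obtain ⟨i, hi⟩ := hper e
  set x := n^[i] e
  have hx : 0 < r x := hiter (pos_of_mul_pos_right he zero_le) i
  set p := Function.minimalPeriod n x with hp
  have hp0 : 0 < p := Function.minimalPeriod_pos_of_mem_periodicPts hi
  have hmem : ∀ k, n^[k] x ∈ Function.periodicPts n := by
    intro k
    obtain ⟨q, hq, hq'⟩ := hi
    exact ⟨q, hq, hq'.apply_iterate k⟩
  intro hb
  have hC : G.IsOrientedCycle (Function.periodicOrbit n x) := by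
    refine ⟨?_, Function.nodup_periodicOrbit, fun _ _ => hpos _, ?_⟩
    · rw [Ne, Function.periodicOrbit_eq_nil_iff_not_periodic_pt, not_not]
      exact hi
    · rw [Function.periodicOrbit_chain' _ hi]
      intro k
      rw [Function.iterate_succ_apply']
      exact (hn _ (hiter hx k)).1.2.2
  have hbal := hb _ hC
  rw [Function.periodicOrbit, cycleWeight_cycleInv_coe, cycleWeight_coe, List.map_map,
    List.map_map, ← hp] at hbal
  change ∏ k ∈ Finset.range p, G.w (n^[k] x) =
    ∏ k ∈ Finset.range p, G.w (G.rev (n^[k] x)) at hbal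
  -- The product over a full period is shift-invariant, so the factors `r` cancel.
  have hshift : ∀ φ : E → ℝ≥0, (∀ y, 0 < r y → 0 < φ y) →
      ∏ k ∈ Finset.range p, φ (n^[k + 1] x) = ∏ k ∈ Finset.range p, φ (n^[k] x) := by
    intro φ hφ
    have h1 := Finset.prod_range_succ' (fun k => φ (n^[k] x)) p
    rw [Finset.prod_range_succ, Function.iterate_minimalPeriod] at h1
    exact (mul_right_cancel₀ (hφ x hx).ne' h1).symm
  have hprod : ∏ k ∈ Finset.range p, (r (n^[k] x) * G.w (G.rev (n^[k] x))) <
      ∏ k ∈ Finset.range p, (G.w (n^[k + 1] x) * r (n^[k + 1] x)) := by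
    refine Finset.prod_lt_prod_of_nonempty (fun k _ => mul_pos (hiter hx k) (hpos _))
      (fun k _ => ?_) ⟨0, Finset.mem_range.2 hp0⟩
    rw [Function.iterate_succ_apply']
    exact hlt (hiter hx k) (hmem k)
  rw [hshift (fun y => G.w y * r y) fun y hy => mul_pos (hpos y) hy, Finset.prod_mul_distrib,
    Finset.prod_mul_distrib, ← hbal, mul_comm] at hprod
  exact lt_irrefl _ hprod

end WeightedGraph

/-! ### The equivalence -/

theorem mainTheorem6 {V E : Type*} [Finite V] [Finite E] (G : WeightedGraph V E)
    (hirr : MarkovChain.Irreducible G.transition) (r : V) :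
    MarkovChain.Transient (G.universalCover r).transition ↔
      G.TwoCycles ∨
        ∃ C : Cycle E, G.IsOrientedCycle C ∧ G.cycleWeight C ≠ G.cycleWeight (G.cycleInv C) := by
  have := Fintype.ofFinite E
  have hconn := WeightedGraph.reflTransGen_posAdj hirr
  constructor
  · intro h
    by_contra! hcon
    obtain ⟨h1, hb⟩ := hcon
    obtain ⟨s, hs, e, he⟩ := G.exists_isEscape_of_returnProb_lt_one r (h (G.coverRoot r))
    exact hs.not_balanced he (WeightedGraph.uniqueRecStep_of_not_twoCycles h1)
      (WeightedGraph.pos_of_balanced hb hconn) hb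
  · intro h
    obtain ⟨s, hs, e, he⟩ : ∃ s, G.IsEscape s ∧ ∃ e, 0 < G.w e * s e := by
      by_cases hb : G.Balanced
      · have hpos := WeightedGraph.pos_of_balanced hb hconn
        have h1 : G.TwoCycles := h.resolve_right fun ⟨C, hC, hne⟩ => hne (hb C hC)
        have h2 : ¬ G.UniqueRecStep := fun hu => hu.not_twoCycles hpos hconn h1
        simp only [WeightedGraph.UniqueRecStep, not_forall] at h2
        obtain ⟨e, f, f', hf, hf', hne⟩ := h2
        obtain ⟨t, ht⟩ := hf.exists_isCircuit
        obtain ⟨t', ht'⟩ := hf'.exists_isCircuit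
        refine ht.exists_isEscape_of_pair ht' hne hpos ?_ ?_
        · rw [← WeightedGraph.cycleWeight_coe, ← WeightedGraph.cycleWeight_cycleInv_coe]
          exact (hb _ ht.isOrientedCycle).symm
        · rw [← WeightedGraph.cycleWeight_coe, ← WeightedGraph.cycleWeight_cycleInv_coe]
          exact (hb _ ht'.isOrientedCycle).symm
      · obtain ⟨C, hC, hlt⟩ : ∃ C, G.IsOrientedCycle C ∧
            G.cycleWeight (G.cycleInv C) < G.cycleWeight C := by
          simp only [WeightedGraph.Balanced, not_forall] at hb
          obtain ⟨C, hC, hne⟩ := hb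
          -- If the inverse is heavier, its weight is positive, so it is itself an oriented cycle
          -- and replaces `C`.
          rcases lt_or_gt_of_ne hne with hlt | hlt
          · refine ⟨_, WeightedGraph.isOrientedCycle_cycleInv hC fun g hg => ?_, ?_⟩
            · obtain ⟨f, t, rfl, -⟩ := hC.exists_isCircuit hg
              rw [WeightedGraph.cycleWeight_cycleInv_coe, List.map_cons, List.prod_cons] at hlt
              exact pos_of_mul_pos_left (zero_le.trans_lt hlt) zero_le
            · rwa [WeightedGraph.cycleInv_cycleInv]
          · exact ⟨C, hC, hlt⟩
        obtain ⟨e, he⟩ := hC.exists_mem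
        obtain ⟨f, t, rfl, ht⟩ := hC.exists_isCircuit he
        rw [WeightedGraph.cycleWeight_coe, WeightedGraph.cycleWeight_cycleInv_coe] at hlt
        exact ht.exists_isEscape hlt
    intro x
    obtain ⟨s', hs', e', he', hpos'⟩ := WeightedGraph.exists_isEscape_at hs he
      (hconn (G.pathEnd r x.1) _)
    exact WeightedGraph.returnProb_lt_one_of_isEscape hs' x he' hpos'
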